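/- For an integer $d\ge 0$ let $\mathrm{T}_d$ be the set of all transpositions in the symmetric group $\mathrm{S}_d$, and let $$\mathrm{As}^+(\mathrm{T}_d)=\langle\, e_x,\ x\in \mathrm{T}_d \mid e_xe_y=e_{xyx^{-1}}e_x,\ x,y\in \mathrm{T}_d\,\rangle$$ be the structure monoid (defined by this monoid presentation) of the solution $(x,y)\mapsto(xyx^{-1},x)$ of the Yang–Baxter equation on $\mathrm{T}_d$. Let $$\mathcal{G}^+_d(t)=\sum_{a\in \mathrm{As}^+(\mathrm{T}_d)}t^{l(a)}\in\mathbb{Q}[[t]]$$ be its growth series, where $l(a)$ is the minimal number of generators $e_x$ in a product equal to $a$. **Theorem.** In $\mathbb{Q}[[t,x]]$ one has $$\sum_{d\ge 0}\frac{1}{d!}\,\mathcal{G}^+_d(t)\,x^d=\exp\left(\frac{(1-tx)^{-t}-1-t^4x}{t^2(1-t^2)}\right).$$ Here $(1-tx)^{-t}=\sum_{n\ge 0}\binom{-t}{n}(-tx)^n$ with $\binom{\alpha}{n}=\frac{\alpha(\alpha-1)\cdots(\alpha-n+1)}{n!}$, the fraction denotes the (unique) series $f\in\mathbb{Q}[[t,x]]$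 with $t^2(1-t^2)f=(1-tx)^{-t}-1-t^4x$ (its existence is part of the claim, as is the vanishing of $f$ at $x=0$), and $\exp(f)=\sum_{n\ge 0}f^n/n!$. -/

import Mathlib

open scoped Pointwise

namespace TranspositionMonoid

/-- The defining relations `e_x e_y = e_{λ_x(y)} e_{ρ_y(x)}` attached to a map
`r (x, y) = (λ_x(y), ρ_y(x))` on a set `X`. -/
inductive StructureRel {X : Type*} (r : X × X → X × X) : FreeMonoid X → FreeMonoid X → Prop
  | of (x y : X) : StructureRel r (FreeMonoid.of x * FreeMonoid.of y)
      (FreeMonoid.of (r (x, y)).1 * FreeMonoid.of (r (x, y)).2)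

/-- The structure monoid `As⁺(X, r)`. -/
abbrev StructureMonoid {X : Type*} (r : X × X → X × X) : Type _ :=
  PresentedMonoid (StructureRel r)

/-- The standard generating set `{e_x : x ∈ X}` of `As⁺(X, r)`. -/
def generators {X : Type*} (r : X × X → X × X) : Set (StructureMonoid r) :=
  Set.range (PresentedMonoid.of (StructureRel r))

/-- The elements of a monoid whose word length with respect to `S` is exactly `n`:
products of `n` elements of `S` that are not products of fewer elements of `S`. -/
def sphere {M : Type*} [Monoid M] (S : Set M) (n : ℕ) : Set M :=
  S ^ n \ ⋃ i < n, S ^ i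

/-- If `S` is finite, then so are the spheres; hence `growthSeries` below counts correctly. -/
theorem sphere_finite {M : Type*} [Monoid M] {S : Set M} (hS : S.Finite) (n : ℕ) :
    (sphere S n).Finite := by
  refine Set.Finite.subset ?_ Set.sdiff_subset
  induction n with
  | zero => rw [pow_zero]; exact Set.finite_one
  | succ n ih => rw [pow_succ]; exact ih.mul hS

/-- The growth series `∑ₙ #(sphere of radius n) tⁿ` of a monoid with respect to `S`. -/
noncomputable def growthSeries {M : Type*} [Monoid M] (S : Set M) : PowerSeries ℚ :=
  PowerSeries.mk fun n => ((sphere S n).ncard : ℚ)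

/-- The set `T_d` of all transpositions of `d` elements. -/
def Transposition (d : ℕ) : Type :=
  {σ : Equiv.Perm (Fin d) // σ.IsSwap}

theorem isSwap_conj {α : Type*} [DecidableEq α] {σ τ : Equiv.Perm α} (hτ : τ.IsSwap) :
    (σ * τ * σ⁻¹).IsSwap := by
  obtain ⟨a, b, hab, rfl⟩ := hτ
  exact ⟨σ a, σ b, fun h => hab (σ.injective h), (Equiv.swap_apply_apply σ a b).symm⟩

/-- The conjugation solution `(x, y) ↦ (x y x⁻¹, x)` on `T_d`. -/
def transpositionSolution (d : ℕ) :
    Transposition d × Transposition d → Transposition d × Transposition d :=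
  fun p => (⟨p.1.1 * p.2.1 * p.1.1⁻¹, isSwap_conj p.2.2⟩, p.1)

theorem generators_finite (d : ℕ) : (generators (transpositionSolution d)).Finite := by
  have : Finite (Transposition d) := Subtype.finite
  exact Set.finite_range _

/-- The growth series `G⁺_d(t)` of `As⁺(T_d)` with respect to its standard generators. -/
noncomputable def transpositionGrowth (d : ℕ) : PowerSeries ℚ :=
  growthSeries (generators (transpositionSolution d))

/-- The variable `t` of `ℚ⟦t, x⟧ = ℚ⟦t⟧⟦x⟧`. -/
noncomputable def tVar : PowerSeries (PowerSeries ℚ) :=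
  PowerSeries.C PowerSeries.X

/-- The variable `x` of `ℚ⟦t, x⟧ = ℚ⟦t⟧⟦x⟧`. -/
noncomputable def xVar : PowerSeries (PowerSeries ℚ) :=
  PowerSeries.X

/-- The binomial series `(1 - t x) ^ (-t)`, i.e. `∑ₙ binom(-t, n) yⁿ` at `y = -t x`. -/
noncomputable def binomialPower : PowerSeries (PowerSeries ℚ) :=
  PowerSeries.subst (-(tVar * xVar))
    (PowerSeries.binomialSeries (PowerSeries ℚ) (-PowerSeries.X : PowerSeries ℚ))

/-- The exponential generating series `∑_d G⁺_d(t) x^d / d!`. -/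
noncomputable def growthEGF : PowerSeries (PowerSeries ℚ) :=
  PowerSeries.mk fun d => (1 / (d.factorial : ℚ)) • transpositionGrowth d

/-- The formal exponential `exp f = ∑ₙ fⁿ / n!`, for `f` without constant term in `x`. -/
noncomputable def formalExp (f : PowerSeries (PowerSeries ℚ)) : PowerSeries (PowerSeries ℚ) :=
  PowerSeries.subst f (PowerSeries.exp (PowerSeries ℚ))

end TranspositionMonoid

/-!
The structure monoid of the transpositions of `d` points is graded by word length, since its
relations are homogeneous. Its elements are classified, one connected component of the graph of
transpositions at a time, as follows.

*Shortest factorizations.* Write `sq i j` for the square of the generator `edge i j`; squares are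
central. By induction on the set of points, with a new point `p` handled by
`g = swap p (g p) * g'` where `g'` fixes `p`, there is a section `s` of the product map `perm` such
that for every `g` and every transposition `x = swap i j` either `edge i j * s g = s (x * g)` or
`edge i j * s (x * g) = s g` (`IsSection`, `exists_isSection`). Hence every element has the form
`s g * Q` with `Q` a product of squares (`IsSection.exists_eq`). The same induction gives
`∑ X ^ (m - length (s g)) = X (X + 1) ⋯ (X + m - 1)`, summed over the permutations of `m` points.

*Rigidity.* In a product `a * sq u v` the points `u`, `v` may be replaced by other points of their
`a`-components (`mul_sq_eq`). An exchange argument then shows that a connected element `s g * Q` is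
determined by `g` and the number `k` of squares (`mul_sqProd_eq`). On `m ≥ 2` points, the numbers
which occur are exactly those with `length (s g) + k + 1 ≥ m`, because `m - 1` generators are needed
to connect `m` points and `s g` is a forest. So the connected elements have the generating function
`t ^ m * t (t + 1) ⋯ (t + m - 1) / (t ^ 2 (1 - t ^ 2))` (`series_connectedSet`), while on a single
point there is only the element `1`, which causes the correction term `t ^ 4 x`.

*Exponential formula.* An element factors uniquely into a connected element on the component of a
given point and an element on the remaining points (`exists_component`, `young_mul_inj`). The
resulting recursion `series_young_insert` is the differential equation `E' = f' E` of `E = exp f`.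
-/

namespace TranspositionMonoid

variable {d : ℕ}

/-! ### Generators and invariants of the structure monoid -/

/-- The structure monoid of the transpositions of `d` points. -/
abbrev TMonoid (d : ℕ) : Type :=
  StructureMonoid (transpositionSolution d)

/-- The generator attached to the transposition of `i` and `j`; by convention it is `1` if
`i = j`, in accordance with `Equiv.swap i i = 1`. -/
noncomputable def edge (i j : Fin d) : TMonoid d :=
  if h : i = j then 1 else PresentedMonoid.of _ ⟨Equiv.swap i j, i, j, h, rfl⟩

@[simp]
theorem edge_self (i : Fin d) : edge i i = 1 := by simp [edge]

theorem edge_of_ne {i j : Fin d} (h : i ≠ j) :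
    edge i j = PresentedMonoid.of _ ⟨Equiv.swap i j, i, j, h, rfl⟩ := by simp [edge, h]

theorem edge_comm (i j : Fin d) : edge i j = edge j i := by
  by_cases h : i = j
  · rw [h]
  · rw [edge_of_ne h, edge_of_ne (Ne.symm h)]
    congr 2
    exact Equiv.swap_comm i j

theorem exists_edge_eq (x : Transposition d) :
    ∃ i j, i ≠ j ∧ x.1 = Equiv.swap i j ∧
      PresentedMonoid.of (StructureRel (transpositionSolution d)) x = edge i j := by
  obtain ⟨σ, i, j, h, rfl⟩ := x
  exact ⟨i, j, h, rfl, (edge_of_ne h).symm⟩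

theorem edge_mul_edge (i j k l : Fin d) :
    edge i j * edge k l = edge (Equiv.swap i j k) (Equiv.swap i j l) * edge i j := by
  by_cases hij : i = j
  · subst hij; simp
  by_cases hkl : k = l
  · subst hkl; simp
  have h' : Equiv.swap i j k ≠ Equiv.swap i j l := fun h => hkl ((Equiv.swap i j).injective h)
  rw [edge_of_ne hij, edge_of_ne hkl, edge_of_ne h']
  have := PresentedMonoid.mk_eq_mk_of_rel (StructureRel.of (r := transpositionSolution d)
    ⟨Equiv.swap i j, i, j, hij, rfl⟩ ⟨Equiv.swap k l, k, l, hkl, rfl⟩)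
  rw [map_mul, map_mul] at this
  refine this.trans ?_
  congr 2
  refine congrArg _ (Subtype.ext ?_)
  exact (Equiv.swap_apply_apply _ k l).symm

theorem edge_induction {P : TMonoid d → Prop} (one : P 1)
    (mul : ∀ i j a, i ≠ j → P a → P (edge i j * a)) (a : TMonoid d) : P a := by
  have h : a ∈ Submonoid.closure
      (Set.range (PresentedMonoid.of (StructureRel (transpositionSolution d)))) := by simp
  induction h using Submonoid.closure_induction_left with
  | one => exact one
  | mul_left x hx y _ ih =>
    obtain ⟨x, rfl⟩ := hx
    obtain ⟨i, j, hij, -, hx⟩ := exists_edge_eq x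
    rw [hx]
    exact mul i j y hij ih

/-- A map on transpositions which turns the defining relations into equalities extends to the
structure monoid. -/
noncomputable def liftHom {N : Type*} [Monoid N] (f : Equiv.Perm (Fin d) → N)
    (hf : ∀ x y : Equiv.Perm (Fin d), x.IsSwap → y.IsSwap → f x * f y = f (x * y * x⁻¹) * f x) :
    TMonoid d →* N :=
  PresentedMonoid.lift (fun x : Transposition d => f x.1) <| by
    rintro _ _ ⟨x, y⟩
    rw [map_mul, map_mul]
    exact hf x.1 y.1 x.2 y.2

theorem liftHom_edge {N : Type*} [Monoid N] (f : Equiv.Perm (Fin d) → N) (hf) {i j : Fin d}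
    (h : i ≠ j) : liftHom f hf (edge i j) = f (Equiv.swap i j) := by
  rw [edge_of_ne h]; rfl

/-- The product of the transpositions occurring in an element of the structure monoid. -/
noncomputable def perm : TMonoid d →* Equiv.Perm (Fin d) :=
  liftHom id fun x y _ _ => by simp

@[simp]
theorem perm_edge (i j : Fin d) : perm (edge i j) = Equiv.swap i j := by
  by_cases h : i = j
  · subst h; simp; rfl
  · exact liftHom_edge _ _ h

/-- The length homomorphism. -/
noncomputable def lengthHom : TMonoid d →* Multiplicative ℕ :=
  liftHom (fun _ => Multiplicative.ofAdd 1) fun _ _ _ _ => rfl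

/-- The number of letters in any word representing an element; all words have the same length
since the defining relations are homogeneous. -/
noncomputable def length (a : TMonoid d) : ℕ := (lengthHom a).toAdd

@[simp] theorem length_one : length (1 : TMonoid d) = 0 := by simp [length]

@[simp] theorem length_mul (a b : TMonoid d) : length (a * b) = length a + length b := by
  simp [length]

theorem length_edge {i j : Fin d} (h : i ≠ j) : length (edge i j) = 1 := by
  rw [length, lengthHom, liftHom_edge _ _ h]; rfl

/-- The relation identifying each point with its image under a permutation, closed up to an
equivalence relation. -/
def permSetoid (x : Equiv.Perm (Fin d)) : Setoid (Fin d) :=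
  Relation.EqvGen.setoid fun i j => x i = j

theorem permSetoid_le {x : Equiv.Perm (Fin d)} {r : Setoid (Fin d)} :
    permSetoid x ≤ r ↔ ∀ i, r i (x i) :=
  ⟨fun h _ => h (Relation.EqvGen.rel _ _ rfl),
    fun h => Setoid.eqvGen_le fun _ _ hij => hij ▸ h _⟩

/-- The equivalence relation of an element, encoded as the operator of joining with it so that it
becomes multiplicative. -/
noncomputable def compHom : TMonoid d →* Function.End (Setoid (Fin d)) :=
  liftHom (fun x r => permSetoid x ⊔ r) <| by
    intro x y _ _
    funext r
    change permSetoid x ⊔ (permSetoid y ⊔ r) = permSetoid (x * y * x⁻¹) ⊔ (permSetoid x ⊔ r)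
    rw [← sup_assoc, ← sup_assoc]
    congr 1
    have key : ∀ z w : Equiv.Perm (Fin d), ∀ s : Setoid (Fin d),
        permSetoid z ≤ s → permSetoid w ≤ s → permSetoid (z * w * z⁻¹) ≤ s := by
      intro z w s hz hw
      rw [permSetoid_le] at hz hw ⊢
      intro i
      have h1 := hz (z⁻¹ i)
      have h2 := hw (z⁻¹ i)
      have h3 := hz (w (z⁻¹ i))
      rw [← Equiv.Perm.mul_apply, mul_inv_cancel, Equiv.Perm.one_apply] at h1
      exact s.trans' (s.symm' h1) (s.trans' h2 h3)
    have hinv : ∀ z : Equiv.Perm (Fin d), permSetoid z⁻¹ ≤ permSetoid z := by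
      intro z
      rw [permSetoid_le]
      intro i
      have := permSetoid_le.1 (le_refl (permSetoid z)) (z⁻¹ i)
      rw [← Equiv.Perm.mul_apply, mul_inv_cancel, Equiv.Perm.one_apply] at this
      exact (permSetoid z).symm' this
    apply le_antisymm
    · refine sup_le le_sup_right ?_
      have := key x⁻¹ (x * y * x⁻¹) (permSetoid (x * y * x⁻¹) ⊔ permSetoid x)
        ((hinv x).trans le_sup_right) le_sup_left
      simpa [mul_assoc] using this
    · exact sup_le (key _ _ _ le_sup_left le_sup_right) le_sup_left

/-- The connected components of the graph formed by the transpositions occurring in `a`. -/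
noncomputable def comp (a : TMonoid d) : Setoid (Fin d) := compHom a ⊥

@[simp] theorem comp_one : comp (1 : TMonoid d) = ⊥ := by
  rw [comp, map_one]; rfl

theorem compHom_edge (i j : Fin d) (r : Setoid (Fin d)) :
    compHom (edge i j) r = permSetoid (Equiv.swap i j) ⊔ r := by
  by_cases h : i = j
  · subst h
    have : permSetoid (1 : Equiv.Perm (Fin d)) = ⊥ :=
      le_bot_iff.1 (permSetoid_le.2 fun i => Setoid.refl' _ i)
    rw [edge_self, Equiv.swap_self, map_one]
    change r = permSetoid (1 : Equiv.Perm (Fin d)) ⊔ r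
    rw [this, bot_sup_eq]
  · exact congrFun (liftHom_edge (N := Function.End (Setoid (Fin d))) _ _ h) r

theorem compHom_apply (a : TMonoid d) (r : Setoid (Fin d)) : compHom a r = comp a ⊔ r := by
  induction a using edge_induction generalizing r with
  | one => rw [comp_one, bot_sup_eq, map_one]; rfl
  | mul i j a h ih =>
    have hc : ∀ s, compHom (edge i j * a) s = compHom (edge i j) (compHom a s) := fun s => by
      rw [map_mul]; rfl
    rw [comp, hc, hc, ih, ih ⊥, compHom_edge, compHom_edge, sup_bot_eq, sup_assoc]

@[simp] theorem comp_mul (a b : TMonoid d) : comp (a * b) = comp a ⊔ comp b := by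
  rw [← compHom_apply, comp, map_mul]; rfl

theorem comp_edge_le {i j : Fin d} {r : Setoid (Fin d)} : comp (edge i j) ≤ r ↔ r i j := by
  rw [comp, compHom_edge, sup_bot_eq, permSetoid_le]
  constructor
  · intro h
    simpa using h i
  · intro h k
    rw [Equiv.swap_apply_def]
    split_ifs with h1 h2
    · exact h1 ▸ h
    · exact h2 ▸ r.symm' h
    · exact r.refl' k

theorem comp_edge (i j : Fin d) : comp (edge i j) i j := comp_edge_le.1 le_rfl

theorem mul_edge (a : TMonoid d) (k l : Fin d) :
    a * edge k l = edge (perm a k) (perm a l) * a := by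
  induction a using edge_induction generalizing k l with
  | one => simp
  | mul i j a _ ih =>
    rw [mul_assoc, ih, ← mul_assoc, edge_mul_edge, mul_assoc]
    simp

/-- The square of a generator. It is central, since the underlying permutation is trivial. -/
noncomputable def sq (i j : Fin d) : TMonoid d := edge i j * edge i j

theorem sq_comm (i j : Fin d) : sq i j = sq j i := by rw [sq, sq, edge_comm]

theorem perm_sq (i j : Fin d) : perm (sq i j) = 1 := by simp [sq]

theorem length_sq {i j : Fin d} (h : i ≠ j) : length (sq i j) = 2 := by
  simp [sq, length_edge h]

theorem comp_sq (i j : Fin d) : comp (sq i j) = comp (edge i j) := by simp [sq]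

theorem sq_mul (i j : Fin d) (a : TMonoid d) : sq i j * a = a * sq i j := by
  induction a using edge_induction with
  | one => simp
  | mul k l a _ ih => rw [← mul_assoc, mul_edge, perm_sq, mul_assoc, ih, mul_assoc]; rfl

theorem mul_sq (a : TMonoid d) (k l : Fin d) :
    a * sq k l = sq (perm a k) (perm a l) * a := by
  rw [sq, ← mul_assoc, mul_edge a, mul_assoc, mul_edge a, ← mul_assoc]; rfl

/-! ### Elements supported in a set of points -/

/-- The submonoid generated by the transpositions of points of `B`. -/
def young (B : Finset (Fin d)) : Submonoid (TMonoid d) :=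
  Submonoid.closure {a | ∃ i ∈ B, ∃ j ∈ B, a = edge i j}

theorem edge_mem_young {B : Finset (Fin d)} {i j : Fin d} (hi : i ∈ B) (hj : j ∈ B) :
    edge i j ∈ young B :=
  Submonoid.subset_closure ⟨i, hi, j, hj, rfl⟩

theorem sq_mem_young {B : Finset (Fin d)} {i j : Fin d} (hi : i ∈ B) (hj : j ∈ B) :
    sq i j ∈ young B :=
  mul_mem (edge_mem_young hi hj) (edge_mem_young hi hj)

theorem young_mono {B C : Finset (Fin d)} (h : B ⊆ C) : young B ≤ young C :=
  Submonoid.closure_mono fun _ ⟨i, hi, j, hj, e⟩ => ⟨i, h hi, j, h hj, e⟩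

@[elab_as_elim]
theorem young_induction {B : Finset (Fin d)} {P : (a : TMonoid d) → a ∈ young B → Prop}
    (one : P 1 (one_mem _))
    (mul : ∀ i (hi : i ∈ B) j (hj : j ∈ B) a (ha : a ∈ young B), i ≠ j → P a ha →
      P (edge i j * a) (mul_mem (edge_mem_young hi hj) ha)) {a : TMonoid d}
    (ha : a ∈ young B) : P a ha := by
  induction ha using Submonoid.closure_induction_left with
  | one => exact one
  | mul_left x hx y hy ih =>
    obtain ⟨i, hi, j, hj, rfl⟩ := hx
    by_cases h : i = j
    · subst h; simpa using ih
    · exact mul i hi j hj y hy h ih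

theorem young_univ : young (Finset.univ : Finset (Fin d)) = ⊤ := by
  rw [eq_top_iff]
  intro a _
  induction a using edge_induction with
  | one => exact one_mem _
  | mul i j a _ ih => exact mul_mem (edge_mem_young (by simp) (by simp)) (ih trivial)

theorem eq_one_of_mem_young {B : Finset (Fin d)} (hB : B.card ≤ 1) {a : TMonoid d}
    (ha : a ∈ young B) : a = 1 := by
  induction ha using young_induction with
  | one => rfl
  | mul i hi j hj a _ hij _ => exact absurd (Finset.card_le_one.1 hB i hi j hj) hij

theorem perm_apply_of_notMem {B : Finset (Fin d)} {a : TMonoid d} (ha : a ∈ young B) {p : Fin d}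
    (hp : p ∉ B) : perm a p = p := by
  induction ha using young_induction with
  | one => simp
  | mul i hi j hj a _ _ ih =>
    rw [map_mul, Equiv.Perm.mul_apply, ih, perm_edge, Equiv.swap_apply_of_ne_of_ne] <;>
    · rintro rfl; contradiction

theorem edge_mul_comm {S T : Finset (Fin d)} (h : Disjoint S T) {u : TMonoid d} (hu : u ∈ young S)
    {i j : Fin d} (hi : i ∈ T) (hj : j ∈ T) : edge i j * u = u * edge i j := by
  rw [mul_edge, perm_apply_of_notMem hu (Finset.disjoint_right.1 h hi),
    perm_apply_of_notMem hu (Finset.disjoint_right.1 h hj)]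

theorem finite_length_eq (n : ℕ) : {a : TMonoid d | length a = n}.Finite := by
  induction n with
  | zero =>
    refine (Set.finite_singleton (1 : TMonoid d)).subset ?_
    intro a
    induction a using edge_induction with
    | one => simp
    | mul i j a h _ => simp [length_edge h]
  | succ n ih =>
    refine ((Set.finite_range fun p : Fin d × Fin d => edge p.1 p.2).mul ih).subset ?_
    intro a
    induction a using edge_induction with
    | one => simp
    | mul i j a h _ =>
      intro hn
      refine Set.mul_mem_mul ⟨(i, j), rfl⟩ ?_
      simp only [Set.mem_ofPred_eq, length_mul, length_edge h] at hn ⊢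
      omega

theorem eq_one_of_length_eq_zero {a : TMonoid d} (h : length a = 0) : a = 1 := by
  induction a using edge_induction with
  | one => rfl
  | mul i j a hij _ => simp [length_edge hij] at h

/-! ### Rigidity of connected elements -/

/-- A square `sq k l` absorbed by `a` may be conjugated by the swap of any two points connected
by `a`. -/
theorem mul_sq_swap {a : TMonoid d} {i j : Fin d} (h : comp a i j) (k l : Fin d) :
    a * sq k l = a * sq (Equiv.swap i j k) (Equiv.swap i j l) := by
  induction a using edge_induction generalizing i j k l with
  | one =>
    rw [comp_one] at h
    obtain rfl : i = j := h
    simp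
  | mul x y a _ ih =>
    -- The swaps with the desired property for all `k`, `l` define an equivalence relation.
    let r : Setoid (Fin d) :=
      { r := fun i j => ∀ k l, edge x y * a * sq k l =
          edge x y * a * sq (Equiv.swap i j k) (Equiv.swap i j l)
        iseqv := by
          refine ⟨fun i k l => by simp, fun {i j} h k l => by rw [Equiv.swap_comm]; exact h k l,
            fun {i j m} hij hjm k l => ?_⟩
          by_cases h1 : i = j
          · subst h1; exact hjm k l
          by_cases h2 : i = m
          · subst h2; simp
          by_cases h3 : j = m
          · subst h3; exact hij k l
          have e : Equiv.swap i m = Equiv.swap i j * Equiv.swap j m * Equiv.swap i j := by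
            rw [Equiv.swap_comm i j, Equiv.swap_comm j m,
              Equiv.swap_mul_swap_mul_swap (Ne.symm h3) (Ne.symm h2)]
          rw [e, hij k l, hjm, hij]; rfl }
    have hr : comp (edge x y * a) ≤ r := by
      rw [comp_mul]
      refine sup_le (comp_edge_le.2 fun k l => ?_) fun i j hij k l => ?_
      · rw [← sq_mul, ← sq_mul, ← mul_assoc, sq_mul k l (edge x y), mul_sq (edge x y), perm_edge,
          mul_assoc]
      · rw [mul_assoc, mul_assoc, ih hij]
    exact hr h k l

theorem mul_sq_eq {a : TMonoid d} {u v p y : Fin d} (hu : comp a u p) (hv : comp a v y)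
    (huv : u ≠ v) (hpy : p ≠ y) : a * sq u v = a * sq p y := by
  rw [mul_sq_swap hu, Equiv.swap_apply_left]
  have hne : p ≠ Equiv.swap u p v := fun h => huv <|
    (Equiv.swap u p).injective ((Equiv.swap_apply_left u p).trans h)
  have hv' : comp a (Equiv.swap u p v) y := by
    rw [Equiv.swap_apply_def, if_neg (Ne.symm huv)]
    split_ifs with h
    · exact (comp a).trans' hu (h ▸ hv)
    · exact hv
  rw [mul_sq_swap hv', Equiv.swap_apply_left, Equiv.swap_apply_of_ne_of_ne hne hpy]

/-- The products of `k` squares of transpositions of points of `B`. -/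
noncomputable def sqProd (B : Finset (Fin d)) (k : ℕ) : Set (TMonoid d) :=
  {a | ∃ i ∈ B, ∃ j ∈ B, i ≠ j ∧ a = sq i j} ^ k

theorem mem_sqProd_zero {B : Finset (Fin d)} {a : TMonoid d} : a ∈ sqProd B 0 ↔ a = 1 := by
  simp [sqProd]

theorem mem_sqProd_succ {B : Finset (Fin d)} {k : ℕ} {a : TMonoid d} :
    a ∈ sqProd B (k + 1) ↔
      ∃ i ∈ B, ∃ j ∈ B, i ≠ j ∧ ∃ Q ∈ sqProd B k, a = sq i j * Q := by
  simp only [sqProd, pow_succ', Set.mem_mul]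
  constructor
  · rintro ⟨_, ⟨i, hi, j, hj, hij, rfl⟩, Q, hQ, rfl⟩
    exact ⟨i, hi, j, hj, hij, Q, hQ, rfl⟩
  · rintro ⟨i, hi, j, hj, hij, Q, hQ, rfl⟩
    exact ⟨_, ⟨i, hi, j, hj, hij, rfl⟩, Q, hQ, rfl⟩

theorem sq_mul_mem_sqProd {B : Finset (Fin d)} {k : ℕ} {Q : TMonoid d} (hQ : Q ∈ sqProd B k)
    {i j : Fin d} (hi : i ∈ B) (hj : j ∈ B) (hij : i ≠ j) : sq i j * Q ∈ sqProd B (k + 1) :=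
  mem_sqProd_succ.2 ⟨i, hi, j, hj, hij, Q, hQ, rfl⟩

theorem sqProd_mono {B C : Finset (Fin d)} (h : B ⊆ C) (k : ℕ) : sqProd B k ⊆ sqProd C k :=
  Set.pow_subset_pow_left fun _ ⟨i, hi, j, hj, e⟩ => ⟨i, h hi, j, h hj, e⟩

/-- Forgetting the squares in a product of squares preserves the components, so that a product of
`k` squares connects no more than a product of `k` generators does. -/
theorem sqProd_spec {B : Finset (Fin d)} {k : ℕ} {Q : TMonoid d} (hQ : Q ∈ sqProd B k) :
    Q ∈ young B ∧ length Q = 2 * k ∧ perm Q = 1 ∧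
      ∃ E ∈ young B, length E = k ∧ comp E = comp Q := by
  induction k generalizing Q with
  | zero =>
    rw [mem_sqProd_zero] at hQ
    subst hQ
    exact ⟨one_mem _, by simp, by simp, 1, one_mem _, by simp, rfl⟩
  | succ k ih =>
    obtain ⟨i, hi, j, hj, hij, R, hR, rfl⟩ := mem_sqProd_succ.1 hQ
    obtain ⟨h1, h2, h3, E, h4, h5, h6⟩ := ih hR
    refine ⟨mul_mem (sq_mem_young hi hj) h1, ?_, ?_, edge i j * E,
      mul_mem (edge_mem_young hi hj) h4, ?_, ?_⟩
    · rw [length_mul, length_sq hij, h2]; ring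
    · rw [map_mul, perm_sq, h3, mul_one]
    · rw [length_mul, length_edge hij, h5]; ring
    · rw [comp_mul, comp_mul, h6, comp_sq]

/-- All points of `S` lie in one component of `a`. -/
def Connects (a : TMonoid d) (S : Finset (Fin d)) : Prop :=
  ∀ i ∈ S, ∀ j ∈ S, comp a i j

theorem Connects.mono {a b : TMonoid d} {S : Finset (Fin d)} (h : Connects a S)
    (hab : comp a ≤ comp b) : Connects b S :=
  fun i hi j hj => hab (h i hi j hj)

/-- If a square `sq u v` joins the components of `p` and `y`, then its end points lie in these two
components, so that `sq p y` has the same effect. -/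
theorem mul_sq_eq_of_joins {b : TMonoid d} {u v p y : Fin d} (huv : u ≠ v)
    (hpy : ¬ comp b p y) (h : comp (b * sq u v) p y) : b * sq u v = b * sq p y := by
  have hne : p ≠ y := fun e => hpy (e ▸ (comp b).refl' p)
  -- Merging the class of `u` into the class of `v` gives an upper bound for the components.
  classical
  let f : Fin d → Quotient (comp b) := fun i =>
    if comp b i u then Quotient.mk _ v else Quotient.mk _ i
  have hle : comp (b * sq u v) ≤ Setoid.ker f := by
    rw [comp_mul, comp_sq]
    refine sup_le (fun i j hij => ?_) (comp_edge_le.2 ?_)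
    · have : comp b i u ↔ comp b j u :=
        ⟨fun h => (comp b).trans' ((comp b).symm' hij) h, fun h => (comp b).trans' hij h⟩
      change f i = f j
      simp only [f, this]
      split_ifs
      · rfl
      · exact Quotient.sound hij
    · change f u = f v
      simp only [f, (comp b).refl' u, if_true]
      split_ifs <;> rfl
  have hf : f p = f y := hle h
  simp only [f] at hf
  by_cases h1 : comp b p u <;> by_cases h2 : comp b y u <;>
    simp only [h1, h2, if_true, if_false] at hf
  · exact absurd ((comp b).trans' h1 ((comp b).symm' h2)) hpy
  · exact mul_sq_eq ((comp b).symm' h1) (Quotient.exact hf) huv hne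
  · rw [sq_comm u v]
    exact mul_sq_eq ((comp b).symm' (Quotient.exact hf)) ((comp b).symm' h2) huv.symm hne
  · exact absurd (Quotient.exact hf) hpy

/-- If a product of squares connects `p` to `y` over `b`, then `sq p y` may be chosen as one of its
factors. -/
theorem exists_sq_factor {S : Finset (Fin d)} {k : ℕ} {b Q : TMonoid d} (hQ : Q ∈ sqProd S (k + 1))
    {p y : Fin d} (hpy : ¬ comp b p y) (h : comp (b * Q) p y) :
    ∃ Q' ∈ sqProd S k, b * Q = b * sq p y * Q' := by
  induction k generalizing b Q with
  | zero =>
    obtain ⟨u, hu, v, hv, huv, R, hR, rfl⟩ := mem_sqProd_succ.1 hQ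
    obtain rfl := mem_sqProd_zero.1 hR
    rw [mul_one] at h ⊢
    exact ⟨1, hR, by rw [mul_sq_eq_of_joins huv hpy h, mul_one]⟩
  | succ k ih =>
    obtain ⟨u, hu, v, hv, huv, R, hR, rfl⟩ := mem_sqProd_succ.1 hQ
    by_cases h' : comp (b * sq u v) p y
    · exact ⟨R, hR, by rw [← mul_assoc, mul_sq_eq_of_joins huv hpy h']⟩
    · rw [← mul_assoc] at h ⊢
      obtain ⟨Q', hQ', e⟩ := ih hR h' h
      exact ⟨sq u v * Q', sq_mul_mem_sqProd hQ' hu hv huv, by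
        rw [e, mul_assoc b, sq_mul, mul_assoc, mul_assoc, mul_assoc]⟩

/-- A connected element is determined by its non-square part and the number of its squares. -/
theorem mul_sqProd_eq {S : Finset (Fin d)} {k : ℕ} {b Q Q' : TMonoid d} (hQ : Q ∈ sqProd S k)
    (hQ' : Q' ∈ sqProd S k) (h : Connects (b * Q) S) (h' : Connects (b * Q') S) :
    b * Q = b * Q' := by
  induction k generalizing b Q Q' with
  | zero => rw [mem_sqProd_zero.1 hQ, mem_sqProd_zero.1 hQ']
  | succ k ih =>
    by_cases hb : Connects b S
    · obtain ⟨u, hu, v, hv, huv, R, hR, rfl⟩ := mem_sqProd_succ.1 hQ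
      obtain ⟨u', hu', v', hv', huv', R', hR', rfl⟩ := mem_sqProd_succ.1 hQ'
      rw [← mul_assoc] at h ⊢
      rw [← mul_assoc] at h' ⊢
      rw [mul_sq_eq (hb u hu u' hu') (hb v hv v' hv') huv huv'] at h ⊢
      exact ih hR hR' h h'
    · simp only [Connects, not_forall] at hb
      obtain ⟨p, hp, y, hy, hpy⟩ := hb
      obtain ⟨R, hR, e⟩ := exists_sq_factor hQ hpy (h p hp y hy)
      obtain ⟨R', hR', e'⟩ := exists_sq_factor hQ' hpy (h' p hp y hy)
      rw [e] at h ⊢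
      rw [e'] at h' ⊢
      exact ih hR hR' h h'

/-! ### Minimal factorizations of permutations -/

/-- The permutations fixing all points outside `B`. -/
def permsOn (B : Finset (Fin d)) : Finset (Equiv.Perm (Fin d)) :=
  Finset.univ.filter fun g => ∀ p, p ∉ B → g p = p

theorem mem_permsOn {B : Finset (Fin d)} {g : Equiv.Perm (Fin d)} :
    g ∈ permsOn B ↔ ∀ p, p ∉ B → g p = p := by simp [permsOn]

theorem perm_mem_permsOn {B : Finset (Fin d)} {a : TMonoid d} (ha : a ∈ young B) :
    perm a ∈ permsOn B :=
  mem_permsOn.2 fun _ hp => perm_apply_of_notMem ha hp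

theorem swap_mul_mem_permsOn {B : Finset (Fin d)} {g : Equiv.Perm (Fin d)} (hg : g ∈ permsOn B)
    {i j : Fin d} (hi : i ∈ B) (hj : j ∈ B) : Equiv.swap i j * g ∈ permsOn B := by
  rw [mem_permsOn] at hg ⊢
  intro p hp
  rw [Equiv.Perm.mul_apply, hg p hp, Equiv.swap_apply_of_ne_of_ne] <;> rintro rfl <;> contradiction

theorem swap_mul_mem_permsOn_of_insert {B : Finset (Fin d)} {p : Fin d} (hp : p ∉ B)
    {g : Equiv.Perm (Fin d)} (hg : g ∈ permsOn (insert p B)) :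
    g p ∈ insert p B ∧ Equiv.swap p (g p) * g ∈ permsOn B := by
  rw [mem_permsOn] at hg
  have h1 : g p ∈ insert p B := by
    by_contra h
    have : p = g p := g.injective (hg _ h).symm
    rw [← this] at h
    simp at h
  refine ⟨h1, mem_permsOn.2 fun q hq => ?_⟩
  by_cases hqp : q = p
  · subst hqp; simp
  · have hq' : q ∉ insert p B := by simp [hq, hqp]
    rw [Equiv.Perm.mul_apply, hg q hq', Equiv.swap_apply_of_ne_of_ne hqp]
    rintro rfl
    exact hq' h1

theorem permsOn_mono {B C : Finset (Fin d)} (h : B ⊆ C) : permsOn B ⊆ permsOn C := fun _ hg =>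
  mem_permsOn.2 fun p hp => mem_permsOn.1 hg p fun hp' => hp (h hp')

theorem sum_permsOn_insert {A : Type*} [AddCommMonoid A] {B : Finset (Fin d)} {p : Fin d}
    (hp : p ∉ B) (F : Equiv.Perm (Fin d) → A) :
    ∑ g ∈ permsOn (insert p B), F g =
      ∑ q ∈ insert p B, ∑ g ∈ permsOn B, F (Equiv.swap p q * g) := by
  rw [← Finset.sum_product']
  refine Finset.sum_nbij' (fun g => (g p, Equiv.swap p (g p) * g))
    (fun x => Equiv.swap p x.1 * x.2) ?_ ?_ ?_ ?_ ?_
  · intro g hg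
    exact Finset.mem_product.2 (swap_mul_mem_permsOn_of_insert hp hg)
  · rintro ⟨q, g⟩ hx
    obtain ⟨hq, hg⟩ := Finset.mem_product.1 hx
    exact swap_mul_mem_permsOn (permsOn_mono (Finset.subset_insert _ _) hg)
      (Finset.mem_insert_self _ _) hq
  · intro g _
    simp [← mul_assoc]
  · rintro ⟨q, g⟩ hx
    obtain ⟨hq, hg⟩ := Finset.mem_product.1 hx
    have : g p = p := mem_permsOn.1 hg p hp
    simp [this, ← mul_assoc]
  · intro g _
    simp [← mul_assoc]

/-- A section of `perm` over the permutations of `B` by shortest factorizations. The field `step`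
expresses that any two shortest factorizations of a permutation define the same element of the
structure monoid; the field `connects` that the graph of a shortest factorization is a forest. -/
structure IsSection (B : Finset (Fin d)) (s : Equiv.Perm (Fin d) → TMonoid d) : Prop where
  one : s 1 = 1
  perm_eq : ∀ g ∈ permsOn B, perm (s g) = g
  mem : ∀ g ∈ permsOn B, s g ∈ young B
  length_le : ∀ g ∈ permsOn B, length (s g) ≤ B.card
  step : ∀ g ∈ permsOn B, ∀ i ∈ B, ∀ j ∈ B,
    edge i j * s g = s (Equiv.swap i j * g) ∨ edge i j * s (Equiv.swap i j * g) = s g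
  connects : B.Nonempty → ∀ g ∈ permsOn B, ∃ k, ∃ Q ∈ sqProd B k,
    length (s g) + k + 1 = B.card ∧ Connects (s g * Q) B
  sum_eq : ∑ g ∈ permsOn B, (PowerSeries.X : PowerSeries ℚ) ^ (B.card - length (s g)) =
    ∏ i ∈ Finset.range B.card, (PowerSeries.X + (i : PowerSeries ℚ))

theorem Connects.insert {a b : TMonoid d} {B : Finset (Fin d)} {p q : Fin d} (h : Connects a B)
    (hq : q ∈ B) (hab : comp a ≤ comp b) (hpq : comp b p q) : Connects b (insert p B) := by
  have key : ∀ i ∈ Insert.insert p B, comp b i q := by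
    intro i hi
    rcases Finset.mem_insert.1 hi with rfl | hi
    · exact hpq
    · exact hab (h i hi q hq)
  exact fun i hi j hj => (comp b).trans' (key i hi) ((comp b).symm' (key j hj))

/-- The section on `insert p B` obtained from one on `B` by splitting off the generator which
moves `p` to its image. -/
noncomputable def extendSection (s : Equiv.Perm (Fin d) → TMonoid d) (p : Fin d)
    (g : Equiv.Perm (Fin d)) : TMonoid d :=
  edge p (g p) * s (Equiv.swap p (g p) * g)

theorem extendSection_swap_mul (s : Equiv.Perm (Fin d) → TMonoid d) {p q : Fin d}
    {g : Equiv.Perm (Fin d)} (hg : g p = p) :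
    extendSection s p (Equiv.swap p q * g) = edge p q * s g := by
  simp [extendSection, hg, ← mul_assoc]

/-- The case of the field `step` for a generator moving the new point. -/
theorem IsSection.extend_step_new {B : Finset (Fin d)} {s : Equiv.Perm (Fin d) → TMonoid d}
    (hs : IsSection B s) {p : Fin d} (hp : p ∉ B) {g : Equiv.Perm (Fin d)}
    (hg : g ∈ permsOn (insert p B)) {b : Fin d} (hb : b ∈ B) :
    edge p b * extendSection s p g = extendSection s p (Equiv.swap p b * g) ∨
      edge p b * extendSection s p (Equiv.swap p b * g) = extendSection s p g := by
  obtain ⟨hq, hg'⟩ := swap_mul_mem_permsOn_of_insert hp hg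
  have hgp : (Equiv.swap p (g p) * g) p = p := by simp
  obtain ⟨q, h, e⟩ : ∃ q h, g p = q ∧ g = Equiv.swap p q * h ∧ h = Equiv.swap p q * g :=
    ⟨_, _, rfl, by simp [← mul_assoc], rfl⟩
  obtain ⟨e1, e2, e3⟩ := e
  rw [e1] at hq hg' hgp
  rw [← e3] at hg' hgp
  clear e1 e3 hg
  subst e2
  by_cases h1 : q = p
  · left
    subst h1
    rw [extendSection_swap_mul s hgp, Equiv.swap_self, edge_self, one_mul]
    exact (extendSection_swap_mul s hgp).symm
  have hqB : q ∈ B := (Finset.mem_insert.1 hq).resolve_left h1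
  by_cases h2 : q = b
  · right
    subst h2
    rw [extendSection_swap_mul s hgp, ← mul_assoc, Equiv.swap_mul_self, one_mul]
    have := extendSection_swap_mul s (q := p) hgp
    rw [Equiv.swap_self, edge_self, one_mul] at this
    congr 1
  have hbp : b ≠ p := fun e => hp (e ▸ hb)
  -- For distinct `p`, `q`, `b`, passing `swap p b` across the split-off `swap p q` turns it into
  -- `swap q b`, a transposition of old points.
  have e : Equiv.swap p b * (Equiv.swap p q * h) = Equiv.swap p q * (Equiv.swap q b * h) := by
    rw [← mul_assoc, ← mul_assoc]
    congr 1
    rw [← Equiv.swap_mul_swap_mul_swap (x := b) (y := q) (z := p) (Ne.symm h2) hbp,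
      Equiv.swap_comm q p, Equiv.swap_comm b q]
    simp [mul_assoc]
  have hp' : (Equiv.swap q b * h) p = p := by
    rw [Equiv.Perm.mul_apply, hgp, Equiv.swap_apply_of_ne_of_ne (Ne.symm h1) (Ne.symm hbp)]
  have hedge : edge p b * edge p q = edge p q * edge q b := by
    rw [edge_mul_edge p q q b, Equiv.swap_apply_right,
      Equiv.swap_apply_of_ne_of_ne hbp (Ne.symm h2)]
  rw [e, extendSection_swap_mul s hgp, extendSection_swap_mul s hp', ← mul_assoc, ← mul_assoc,
    hedge, mul_assoc, mul_assoc]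
  rcases hs.step h hg' q hqB b hb with h | h
  · left; rw [h]
  · right; rw [h]

theorem IsSection.extend {B : Finset (Fin d)} {s : Equiv.Perm (Fin d) → TMonoid d}
    (hs : IsSection B s) {p : Fin d} (hp : p ∉ B) :
    IsSection (insert p B) (extendSection s p) where
  one := by
    rw [← hs.one, extendSection, Equiv.Perm.one_apply, Equiv.swap_self, edge_self, one_mul]; rfl
  perm_eq g hg := by
    rw [extendSection, map_mul, hs.perm_eq _ (swap_mul_mem_permsOn_of_insert hp hg).2, perm_edge,
      ← mul_assoc, Equiv.swap_mul_self, one_mul]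
  mem g hg := by
    obtain ⟨h1, h2⟩ := swap_mul_mem_permsOn_of_insert hp hg
    exact mul_mem (edge_mem_young (Finset.mem_insert_self _ _) h1)
      (young_mono (Finset.subset_insert _ _) (hs.mem _ h2))
  length_le g hg := by
    have h2 := hs.length_le _ (swap_mul_mem_permsOn_of_insert hp hg).2
    rw [extendSection, length_mul, Finset.card_insert_of_notMem hp]
    by_cases h : p = g p
    · rw [← h] at h2 ⊢
      rw [edge_self, length_one]
      omega
    · rw [length_edge h]
      omega
  step g hg i hi j hj := by
    by_cases hij : i = j
    · left; subst hij; simp; rfl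
    rcases Finset.mem_insert.1 hi with rfl | hiB
    · exact hs.extend_step_new hp hg ((Finset.mem_insert.1 hj).resolve_left (Ne.symm hij))
    rcases Finset.mem_insert.1 hj with rfl | hjB
    · rw [edge_comm, Equiv.swap_comm]
      exact hs.extend_step_new hp hg hiB
    · -- A generator fixing `p` passes the split-off generator, replacing `g p` by its image.
      obtain ⟨hq, hg'⟩ := swap_mul_mem_permsOn_of_insert hp hg
      have hσ : Equiv.swap i j p = p := by
        rw [Equiv.swap_apply_of_ne_of_ne] <;> rintro rfl <;> contradiction
      have e1 : extendSection s p (Equiv.swap i j * g) =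
          edge p (Equiv.swap i j (g p)) * s (Equiv.swap i j * (Equiv.swap p (g p) * g)) := by
        rw [extendSection]
        congr 2
        rw [Equiv.Perm.mul_apply, ← mul_assoc, ← mul_assoc]
        congr 1
        have := Equiv.swap_apply_apply (Equiv.swap i j) p (g p)
        rw [hσ] at this
        rw [this]
        simp [mul_assoc]
      have e2 : edge i j * edge p (g p) = edge p (Equiv.swap i j (g p)) * edge i j := by
        rw [edge_mul_edge, hσ]
      have e3 : edge i j * edge p (Equiv.swap i j (g p)) = edge p (g p) * edge i j := by
        rw [edge_mul_edge, hσ, Equiv.swap_apply_self]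
      rw [e1, extendSection]
      rcases hs.step _ hg' i hiB j hjB with h | h
      · left; rw [← mul_assoc, e2, mul_assoc, h]
      · right; rw [← mul_assoc, e3, mul_assoc, h]
  connects _ g hg := by
    obtain ⟨hq, hg'⟩ := swap_mul_mem_permsOn_of_insert hp hg
    rw [Finset.card_insert_of_notMem hp]
    rcases B.eq_empty_or_nonempty with rfl | hB
    · have hgp : g p = p := by simpa using hq
      have h1 := hs.length_le _ hg'
      refine ⟨0, 1, mem_sqProd_zero.2 rfl, ?_, ?_⟩
      · rw [extendSection, length_mul]
        rw [hgp] at h1 ⊢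
        rw [edge_self, length_one]
        simp only [Finset.card_empty] at h1 ⊢
        omega
      · intro i hi j hj
        obtain rfl : i = p := by simpa using hi
        obtain rfl : j = i := by simpa using hj
        exact Setoid.refl' _ _
    · obtain ⟨k, Q, hQ, hk, hc⟩ := hs.connects hB _ hg'
      have hQ' := sqProd_mono (Finset.subset_insert p B) k hQ
      by_cases h : g p = p
      · obtain ⟨b, hb⟩ := hB
        have hbp : p ≠ b := fun e => hp (e ▸ hb)
        refine ⟨k + 1, sq p b * Q, sq_mul_mem_sqProd hQ' (Finset.mem_insert_self _ _)
          (Finset.mem_insert_of_mem hb) hbp, ?_, ?_⟩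
        · rw [extendSection, length_mul]
          rw [h] at hk ⊢
          rw [edge_self, length_one]
          omega
        · refine hc.insert hb ?_ ?_
          · simp only [comp_mul, extendSection]
            exact sup_le (le_sup_right.trans le_sup_left) (le_sup_right.trans le_sup_right)
          · rw [comp_mul, comp_mul, comp_sq]
            exact (le_sup_left.trans le_sup_right : comp (edge p b) ≤ _) (comp_edge p b)
      · refine ⟨k, Q, hQ', ?_, ?_⟩
        · rw [extendSection, length_mul, length_edge (Ne.symm h)]
          omega
        · refine hc.insert ((Finset.mem_insert.1 hq).resolve_left h) ?_ ?_
          · simp only [comp_mul, extendSection]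
            exact sup_le (le_sup_right.trans le_sup_left) le_sup_right
          · rw [comp_mul, extendSection, comp_mul]
            exact (le_sup_left.trans le_sup_left : comp (edge p (g p)) ≤ _) (comp_edge _ _)
  sum_eq := by
    have hgp : ∀ g ∈ permsOn B, g p = p := fun g hg => mem_permsOn.1 hg p hp
    rw [sum_permsOn_insert hp, Finset.sum_insert hp, Finset.card_insert_of_notMem hp,
      Finset.prod_range_succ, ← hs.sum_eq, mul_add, Finset.sum_mul]
    congr 1
    · refine Finset.sum_congr rfl fun g hg => ?_
      rw [extendSection_swap_mul s (hgp g hg), edge_self, one_mul,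
        Nat.succ_sub (hs.length_le g hg), pow_succ]
    · rw [Finset.sum_congr rfl (g := fun _ => ∑ g ∈ permsOn B,
          (PowerSeries.X : PowerSeries ℚ) ^ (B.card - length (s g)))]
      · rw [Finset.sum_const, nsmul_eq_mul, mul_comm]
      · intro q hq
        refine Finset.sum_congr rfl fun g hg => ?_
        have hne : p ≠ q := fun e => hp (e ▸ hq)
        rw [extendSection_swap_mul s (hgp g hg), length_mul, length_edge hne, add_comm 1,
          Nat.add_sub_add_right]

theorem exists_isSection (B : Finset (Fin d)) : ∃ s, IsSection B s := by
  induction B using Finset.induction_on with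
  | empty =>
    have h : permsOn (∅ : Finset (Fin d)) = {1} := by
      ext g
      simp [mem_permsOn, Equiv.ext_iff]
    refine ⟨fun _ => 1, ⟨?_, ?_, ?_, ?_, ?_, ?_, ?_⟩⟩ <;> simp [h]
  | insert p B hp ih =>
    obtain ⟨s, hs⟩ := ih
    exact ⟨_, hs.extend hp⟩

/-- Every element is a shortest factorization times a product of squares. -/
theorem IsSection.exists_eq {B : Finset (Fin d)} {s : Equiv.Perm (Fin d) → TMonoid d}
    (hs : IsSection B s) {a : TMonoid d} (ha : a ∈ young B) :
    ∃ k, ∃ Q ∈ sqProd B k, a = s (perm a) * Q := by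
  induction ha using young_induction with
  | one =>
    exact ⟨0, 1, mem_sqProd_zero.2 rfl, by rw [map_one, hs.one, one_mul]⟩
  | mul i hi j hj a ha hij ih =>
    obtain ⟨k, Q, hQ, e⟩ := ih
    rw [map_mul, perm_edge]
    rcases hs.step _ (perm_mem_permsOn ha) i hi j hj with h | h
    · exact ⟨k, Q, hQ, by rw [← h, mul_assoc, ← e]⟩
    · refine ⟨k + 1, sq i j * Q, sq_mul_mem_sqProd hQ hi hj hij, ?_⟩
      rw [← mul_assoc, ← sq_mul, sq, mul_assoc (edge i j), h, mul_assoc, ← e]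

/-! ### Splitting off a connected component -/

/-- The elements supported in `S` which connect all points of `S`. -/
def connectedSet (S : Finset (Fin d)) : Set (TMonoid d) :=
  {u | u ∈ young S ∧ Connects u S}

theorem eq_one_or_exists_eq_edge_mul {B : Finset (Fin d)} {a : TMonoid d} (ha : a ∈ young B) :
    a = 1 ∨ ∃ i ∈ B, ∃ j ∈ B, i ≠ j ∧ ∃ b ∈ young B, a = edge i j * b := by
  induction ha using young_induction with
  | one => exact Or.inl rfl
  | mul i hi j hj b hb hij _ => exact Or.inr ⟨i, hi, j, hj, hij, b, hb, rfl⟩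

/-- Every element splits off the component of a given point. The estimate
holds since each generator enlarges a component by joining it to at most one other. -/
theorem exists_component {B : Finset (Fin d)} {a : TMonoid d} (ha : a ∈ young B) {p : Fin d}
    (hp : p ∈ B) :
    ∃ S ⊆ B, p ∈ S ∧ ∃ u ∈ connectedSet S, ∃ v ∈ young (B \ S),
      a = u * v ∧ S.card ≤ length u + 1 := by
  generalize hn : length a = n
  induction n using Nat.strong_induction_on generalizing a B p with
  | _ n ih =>
  subst hn
  rcases eq_one_or_exists_eq_edge_mul ha with rfl | ⟨i, hi, j, hj, hij, a, ha', rfl⟩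
  · refine ⟨{p}, by simpa using hp, by simp, 1, ⟨one_mem _, ?_⟩, 1, one_mem _, by simp, by simp⟩
    intro i hi j hj
    rw [Finset.mem_singleton.1 hi, Finset.mem_singleton.1 hj]
  have hlen : length a < length (edge i j * a) := by rw [length_mul, length_edge hij]; omega
  obtain ⟨S, hSB, hpS, u, ⟨huS, hu⟩, v, hv, e, hcard⟩ := ih (length a) hlen ha' hp rfl
  -- If the generator crosses the boundary of `S`, the component of its outer end point is added.
  have cross : ∀ i j : Fin d, i ≠ j → i ∈ S → j ∈ B → j ∉ S →
      ∃ S ⊆ B, p ∈ S ∧ ∃ u ∈ connectedSet S, ∃ v ∈ young (B \ S),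
        edge i j * a = u * v ∧ S.card ≤ length u + 1 := by
    intro i j hij hiS hjB hjS
    have hlv : length v < length (edge i j * a) := by
      rw [length_mul, length_edge hij, e, length_mul]; omega
    have hlv' : length v < length a + 1 := by
      rw [e, length_mul]; omega
    obtain ⟨T, hTB, hjT, w, ⟨hwT, hw⟩, z, hz, e', hcard'⟩ :=
      ih (length v) (by omega) hv (Finset.mem_sdiff.2 ⟨hjB, hjS⟩) rfl
    have h1 : comp u ≤ comp (edge i j * u * w) := by
      rw [comp_mul, comp_mul]; exact le_sup_right.trans le_sup_left
    have h2 : comp w ≤ comp (edge i j * u * w) := by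
      rw [comp_mul, comp_mul]; exact le_sup_right
    have h3 : comp (edge i j * u * w) i j := by
      have : comp (edge i j) ≤ comp (edge i j * u * w) := by
        rw [comp_mul, comp_mul]; exact le_sup_left.trans le_sup_left
      exact this (comp_edge i j)
    have key : ∀ k ∈ S ∪ T, comp (edge i j * u * w) k i := by
      intro k hk
      rcases Finset.mem_union.1 hk with hk | hk
      · exact h1 (hu k hk i hiS)
      · exact Setoid.trans' _ (h2 (hw k hk j hjT)) (Setoid.symm' _ h3)
    refine ⟨S ∪ T, Finset.union_subset hSB (hTB.trans Finset.sdiff_subset),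
      Finset.mem_union_left _ hpS, edge i j * u * w, ⟨?_, ?_⟩, z, ?_, ?_, ?_⟩
    · exact mul_mem (mul_mem (edge_mem_young (Finset.mem_union_left _ hiS)
        (Finset.mem_union_right _ hjT)) (young_mono Finset.subset_union_left huS))
        (young_mono Finset.subset_union_right hwT)
    · exact fun k hk l hl => Setoid.trans' _ (key k hk) (Setoid.symm' _ (key l hl))
    · rwa [sdiff_sdiff, Finset.sup_eq_union] at hz
    · rw [e, e']; simp only [mul_assoc]
    · rw [length_mul, length_mul, length_edge hij]
      have := Finset.card_union_le S T
      omega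
  by_cases hiS : i ∈ S <;> by_cases hjS : j ∈ S
  · refine ⟨S, hSB, hpS, edge i j * u, ⟨mul_mem (edge_mem_young hiS hjS) huS, hu.mono ?_⟩, v, hv,
      by rw [e, mul_assoc], ?_⟩
    · rw [comp_mul]; exact le_sup_right
    · rw [length_mul]; omega
  · exact cross i j hij hiS hj hjS
  · rw [edge_comm]
    exact cross j i hij.symm hjS hi hiS
  · have hi' := Finset.mem_sdiff.2 ⟨hi, hiS⟩
    have hj' := Finset.mem_sdiff.2 ⟨hj, hjS⟩
    refine ⟨S, hSB, hpS, u, ⟨huS, hu⟩, edge i j * v, mul_mem (edge_mem_young hi' hj') hv, ?_, hcard⟩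
    rw [e, ← mul_assoc, ← mul_assoc, edge_mul_comm Finset.disjoint_sdiff huS hi' hj']

theorem comp_le_of_mem_young {B : Finset (Fin d)} {a : TMonoid d} (ha : a ∈ young B)
    {r : Setoid (Fin d)} (hr : ∀ i ∈ B, ∀ j ∈ B, r i j) : comp a ≤ r := by
  induction ha using young_induction with
  | one => rw [comp_one]; exact bot_le
  | mul i hi j hj a _ _ ih =>
    rw [comp_mul]
    exact sup_le (comp_edge_le.2 (hr i hi j hj)) ih

/-- The points of a component are recovered from the product. -/
theorem comp_mul_iff_mem {S T : Finset (Fin d)} (hST : Disjoint S T) {u v : TMonoid d}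
    (hu : u ∈ connectedSet S) (hv : v ∈ young T) {p : Fin d} (hp : p ∈ S) (j : Fin d) :
    comp (u * v) p j ↔ j ∈ S := by
  constructor
  · intro h
    have hle : comp (u * v) ≤ Setoid.ker (fun i => i ∈ S) := by
      rw [comp_mul]
      refine sup_le (comp_le_of_mem_young hu.1 fun i hi j hj => ?_)
        (comp_le_of_mem_young hv fun i hi j hj => ?_)
      · exact propext ⟨fun _ => hj, fun _ => hi⟩
      · exact propext ⟨fun h => absurd hi (Finset.disjoint_left.1 hST h),
          fun h => absurd hj (Finset.disjoint_left.1 hST h)⟩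
    have : (p ∈ S) = (j ∈ S) := hle h
    exact this ▸ hp
  · intro hj
    rw [comp_mul]
    exact (le_sup_left : comp u ≤ _) (hu.2 p hp j hj)

/-- Connecting `m` points takes at least `m - 1` generators. -/
theorem card_le_length_add_one {B S : Finset (Fin d)} (hS : S.Nonempty) (hSB : S ⊆ B)
    {a : TMonoid d} (ha : a ∈ young B) (hc : Connects a S) : S.card ≤ length a + 1 := by
  obtain ⟨p, hp⟩ := hS
  obtain ⟨T, -, hpT, u, hu, v, hv, rfl, hT⟩ := exists_component ha (hSB hp)
  have : S ⊆ T := fun j hj =>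
    (comp_mul_iff_mem Finset.disjoint_sdiff hu hv hpT j).1 (hc p hp j hj)
  have := Finset.card_le_card this
  rw [length_mul]
  omega

/-- The generator attached to a permutation, which is meaningful for transpositions only. -/
noncomputable def gen (x : Equiv.Perm (Fin d)) : TMonoid d :=
  open Classical in if h : x.IsSwap then PresentedMonoid.of _ ⟨x, h⟩ else 1

theorem gen_swap {i j : Fin d} (h : i ≠ j) : gen (Equiv.swap i j) = edge i j := by
  have h' : (Equiv.swap i j).IsSwap := ⟨i, j, h, rfl⟩
  rw [gen, dif_pos h', edge_of_ne h]

open Classical in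
/-- The value of the restriction to `S` at a transposition: transpositions of points of `S` are
kept, those of points outside `S` are dropped, and those crossing the boundary are sent to zero. -/
noncomputable def restrictFun (S : Finset (Fin d)) (x : Equiv.Perm (Fin d)) :
    WithZero (TMonoid d) :=
  if ∀ p ∉ S, x p = p then (gen x : TMonoid d) else if ∀ p ∈ S, x p = p then 1 else 0

open Classical in
theorem restrictFun_swap (S : Finset (Fin d)) {i j : Fin d} (h : i ≠ j) :
    restrictFun S (Equiv.swap i j) =
      if i ∈ S ∧ j ∈ S then ((edge i j : TMonoid d) : WithZero (TMonoid d))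
      else if i ∉ S ∧ j ∉ S then 1 else 0 := by
  have key : ∀ P : Fin d → Prop, (∀ p, P p → Equiv.swap i j p = p) ↔ ¬ P i ∧ ¬ P j := by
    intro P
    constructor
    · intro hP
      refine ⟨fun hi => h ?_, fun hj => h ?_⟩
      · simpa using (hP i hi).symm
      · simpa using hP j hj
    · rintro ⟨hi, hj⟩ p hp
      rw [Equiv.swap_apply_of_ne_of_ne] <;> rintro rfl <;> contradiction
  rw [restrictFun, gen_swap h]
  simp only [key, not_not]

/-- Restriction to `S`. It is multiplicative since conjugation by a transposition which does not
cross the boundary of `S` preserves `S`. -/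
noncomputable def restrict (S : Finset (Fin d)) : TMonoid d →* WithZero (TMonoid d) :=
  liftHom (restrictFun S) <| by
    classical
    rintro _ _ ⟨i, j, hij, rfl⟩ ⟨k, l, hkl, rfl⟩
    rw [← Equiv.swap_apply_apply]
    have hkl' : Equiv.swap i j k ≠ Equiv.swap i j l := fun h => hkl ((Equiv.swap i j).injective h)
    rw [restrictFun_swap S hij, restrictFun_swap S hkl, restrictFun_swap S hkl']
    have hmem : (i ∈ S ↔ j ∈ S) → ∀ m, Equiv.swap i j m ∈ S ↔ m ∈ S := by
      intro h m
      rw [Equiv.swap_apply_def]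
      split_ifs with h1 h2
      · rw [h1, h]
      · rw [h2, h]
      · rfl
    by_cases hS : i ∈ S ↔ j ∈ S
    · simp only [hmem hS]
      by_cases hi : i ∈ S
      · have hj := hS.1 hi
        simp only [hi, hj, and_self, if_true]
        split_ifs
        · rw [← WithZero.coe_mul, edge_mul_edge, WithZero.coe_mul]
        · simp
        · simp
      · have hj : j ∉ S := fun h => hi (hS.2 h)
        rw [if_neg fun h => hi h.1, if_pos ⟨hi, hj⟩, one_mul, mul_one]
        by_cases h1 : k ∈ S ∧ l ∈ S
        · have hk : Equiv.swap i j k = k :=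
            Equiv.swap_apply_of_ne_of_ne (fun e => hi (e ▸ h1.1)) fun e => hj (e ▸ h1.1)
          have hl : Equiv.swap i j l = l :=
            Equiv.swap_apply_of_ne_of_ne (fun e => hi (e ▸ h1.2)) fun e => hj (e ▸ h1.2)
          rw [hk, hl]
        · rw [if_neg h1, if_neg h1]
    · have h1 : ¬ (i ∈ S ∧ j ∈ S) := by tauto
      have h2 : ¬ (i ∉ S ∧ j ∉ S) := by tauto
      simp [h1, h2]

theorem restrict_of_mem {S : Finset (Fin d)} {u : TMonoid d} (hu : u ∈ young S) :
    restrict S u = u := by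
  induction hu using young_induction with
  | one => simp
  | mul i hi j hj a _ hij ih =>
    rw [map_mul, ih, restrict, liftHom_edge _ _ hij, restrictFun_swap S hij]
    simp [hi, hj]

theorem restrict_of_disjoint {S T : Finset (Fin d)} (h : Disjoint S T) {v : TMonoid d}
    (hv : v ∈ young T) : restrict S v = 1 := by
  induction hv using young_induction with
  | one => simp
  | mul i hi j hj a _ hij ih =>
    rw [map_mul, ih, restrict, liftHom_edge _ _ hij, restrictFun_swap S hij]
    simp [Finset.disjoint_right.1 h hi, Finset.disjoint_right.1 h hj]

/-- Both factors are recovered from the product by restriction. -/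
theorem young_mul_inj {S T : Finset (Fin d)} (h : Disjoint S T) {u u' v v' : TMonoid d}
    (hu : u ∈ young S) (hu' : u' ∈ young S) (hv : v ∈ young T) (hv' : v' ∈ young T)
    (e : u * v = u' * v') : u = u' ∧ v = v' := by
  have h1 := congrArg (restrict S) e
  have h2 := congrArg (restrict T) e
  rw [map_mul, map_mul, restrict_of_mem hu, restrict_of_mem hu', restrict_of_disjoint h hv,
    restrict_of_disjoint h hv', mul_one, mul_one] at h1
  rw [map_mul, map_mul, restrict_of_mem hv, restrict_of_mem hv', restrict_of_disjoint h.symm hu,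
    restrict_of_disjoint h.symm hu', one_mul, one_mul] at h2
  exact ⟨WithZero.coe_injective h1, WithZero.coe_injective h2⟩

/-! ### Growth series of subsets -/

/-- The generating function of a set of elements by length. -/
noncomputable def series (A : Set (TMonoid d)) : PowerSeries ℚ :=
  PowerSeries.mk fun n => ((A ∩ {a | length a = n}).ncard : ℚ)

theorem finite_inter_length (A : Set (TMonoid d)) (n : ℕ) : (A ∩ {a | length a = n}).Finite :=
  (finite_length_eq n).subset Set.inter_subset_right

theorem series_mul {A B : Set (TMonoid d)} (h : ∀ u ∈ A, ∀ u' ∈ A, ∀ v ∈ B, ∀ v' ∈ B,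
    u * v = u' * v' → u = u' ∧ v = v') : series (A * B) = series A * series B := by
  classical
  ext n
  rw [PowerSeries.coeff_mul]
  simp only [series, PowerSeries.coeff_mk]
  have hset : ∀ (C : Set (TMonoid d)) m, (C ∩ {a | length a = m}).ncard =
      (finite_inter_length C m).toFinset.card := fun C m => Set.ncard_eq_toFinset_card _ _
  have key : (finite_inter_length (A * B) n).toFinset =
      (Finset.HasAntidiagonal.antidiagonal n).biUnion fun ij =>
      ((finite_inter_length A ij.1).toFinset ×ˢ (finite_inter_length B ij.2).toFinset).image
        fun x => x.1 * x.2 := by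
    ext a
    simp only [Set.Finite.mem_toFinset, Finset.mem_biUnion, Finset.mem_image, Finset.mem_product,
      Set.mem_inter_iff, Set.mem_ofPred_eq, Finset.HasAntidiagonal.mem_antidiagonal, Set.mem_mul,
      Prod.exists]
    constructor
    · rintro ⟨⟨u, hu, v, hv, rfl⟩, hn⟩
      exact ⟨_, _, by rw [← hn, length_mul], u, v, ⟨⟨hu, rfl⟩, hv, rfl⟩, rfl⟩
    · rintro ⟨i, j, hij, u, v, ⟨⟨hu, rfl⟩, hv, rfl⟩, rfl⟩
      exact ⟨⟨u, hu, v, hv, rfl⟩, by rw [length_mul, hij]⟩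
  rw [hset, key, Finset.card_biUnion, Nat.cast_sum]
  · refine Finset.sum_congr rfl fun ij _ => ?_
    rw [Finset.card_image_of_injOn, Finset.card_product, hset, hset, Nat.cast_mul]
    rintro ⟨u, v⟩ hx ⟨u', v'⟩ hx' e
    simp only [Finset.coe_product, Set.mem_prod, Finset.mem_coe, Set.Finite.mem_toFinset] at hx hx'
    obtain ⟨h1, h2⟩ := h u hx.1.1 u' hx'.1.1 v hx.2.1 v' hx'.2.1 e
    exact Prod.ext h1 h2
  · rintro ⟨i, j⟩ _ ⟨i', j'⟩ _ hne
    rw [Function.onFun, Finset.disjoint_left]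
    intro a ha ha'
    simp only [Finset.mem_image, Finset.mem_product, Set.Finite.mem_toFinset, Set.mem_inter_iff,
      Set.mem_ofPred_eq, Prod.exists] at ha ha'
    obtain ⟨u, v, ⟨⟨hu, rfl⟩, hv, rfl⟩, rfl⟩ := ha
    obtain ⟨u', v', ⟨⟨hu', rfl⟩, hv', rfl⟩, e⟩ := ha'
    obtain ⟨rfl, rfl⟩ := h u' hu' u hu v' hv' v hv e
    exact hne rfl

theorem series_biUnion {ι : Type*} (I : Finset ι) (A : ι → Set (TMonoid d))
    (h : ∀ i ∈ I, ∀ j ∈ I, ∀ a, a ∈ A i → a ∈ A j → i = j) :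
    series (⋃ i ∈ I, A i) = ∑ i ∈ I, series (A i) := by
  classical
  ext n
  rw [map_sum]
  simp only [series, PowerSeries.coeff_mk]
  have hset : ∀ (C : Set (TMonoid d)) m, (C ∩ {a | length a = m}).ncard =
      (finite_inter_length C m).toFinset.card := fun C m => Set.ncard_eq_toFinset_card _ _
  have key : (finite_inter_length (⋃ i ∈ I, A i) n).toFinset =
      I.biUnion fun i => (finite_inter_length (A i) n).toFinset := by
    ext a
    simp only [Set.Finite.mem_toFinset, Finset.mem_biUnion, Set.mem_inter_iff, Set.mem_iUnion,
      exists_prop]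
    tauto
  rw [hset, key, Finset.card_biUnion, Nat.cast_sum]
  · exact Finset.sum_congr rfl fun i _ => by rw [hset]
  · intro i hi j hj hne
    rw [Function.onFun, Finset.disjoint_left]
    intro a ha ha'
    simp only [Set.Finite.mem_toFinset] at ha ha'
    exact hne (h i hi j hj a ha.1 ha'.1)

theorem series_one : series ({1} : Set (TMonoid d)) = 1 := by
  ext n
  rw [series, PowerSeries.coeff_mk, PowerSeries.coeff_one]
  by_cases hn : n = 0
  · subst hn
    rw [if_pos rfl, show ({1} : Set (TMonoid d)) ∩ {a | length a = 0} = {1} by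
      ext a; simp only [Set.mem_inter_iff, Set.mem_singleton_iff, Set.mem_ofPred_eq]
      exact ⟨fun h => h.1, fun h => ⟨h, by rw [h, length_one]⟩⟩]
    simp
  · rw [if_neg hn, show ({1} : Set (TMonoid d)) ∩ {a | length a = n} = ∅ by
      ext a; simp only [Set.mem_inter_iff, Set.mem_singleton_iff, Set.mem_ofPred_eq,
        Set.mem_empty_iff_false, iff_false]
      rintro ⟨rfl, h⟩
      exact hn (by rw [← h, length_one])]
    simp

/-- Splitting off the component of the point `p`. -/
theorem series_young_insert {B : Finset (Fin d)} {p : Fin d} (hp : p ∉ B) :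
    series (young (insert p B) : Set (TMonoid d)) = ∑ S ∈ B.powerset,
      series (connectedSet (insert p S)) * series (young (B \ S) : Set (TMonoid d)) := by
  have hdisj : ∀ S : Finset (Fin d), Disjoint (insert p S) (B \ S) := by
    intro S
    rw [Finset.disjoint_insert_left]
    exact ⟨fun h => hp (Finset.mem_sdiff.1 h).1, Finset.disjoint_sdiff⟩
  have hset : (young (insert p B) : Set (TMonoid d)) =
      ⋃ S ∈ B.powerset, connectedSet (insert p S) * (young (B \ S) : Set (TMonoid d)) := by
    ext a
    simp only [Set.mem_iUnion, exists_prop, Finset.mem_powerset, Set.mem_mul, SetLike.mem_coe]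
    constructor
    · intro ha
      obtain ⟨S, hSB, hpS, u, hu, v, hv, rfl, -⟩ :=
        exists_component ha (Finset.mem_insert_self p B)
      refine ⟨S.erase p, Finset.subset_insert_iff.1 hSB, u, ?_, v, ?_, rfl⟩
      · rwa [Finset.insert_erase hpS]
      · convert hv using 2
        ext q
        simp only [Finset.mem_sdiff, Finset.mem_erase, Finset.mem_insert]
        constructor
        · rintro ⟨h1, h2⟩
          exact ⟨Or.inr h1, fun h => h2 ⟨fun e => hp (e ▸ h1), h⟩⟩
        · rintro ⟨h1, h2⟩
          exact ⟨h1.resolve_left fun e => h2 (e ▸ hpS), fun h => h2 h.2⟩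
    · rintro ⟨S, hSB, u, hu, v, hv, rfl⟩
      exact mul_mem (young_mono (Finset.insert_subset_insert p hSB) hu.1)
        (young_mono (Finset.sdiff_subset.trans (Finset.subset_insert p B)) hv)
  rw [hset, series_biUnion]
  · refine Finset.sum_congr rfl fun S _ => series_mul ?_
    intro u hu u' hu' v hv v' hv' e
    exact young_mul_inj (hdisj S) hu.1 hu'.1 hv hv' e
  · rintro S hS S' hS' a ⟨u, hu, v, hv, rfl⟩ ⟨u', hu', v', hv', e⟩
    have e' : u' * v' = u * v := e
    have hpS : p ∉ S := fun h => hp (Finset.mem_powerset.1 hS h)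
    have hpS' : p ∉ S' := fun h => hp (Finset.mem_powerset.1 hS' h)
    have : insert p S = insert p S' := by
      ext q
      rw [← comp_mul_iff_mem (hdisj S) hu hv (Finset.mem_insert_self p S) q,
        ← comp_mul_iff_mem (hdisj S') hu' hv' (Finset.mem_insert_self p S') q, e']
    rw [← Finset.erase_insert hpS, this, Finset.erase_insert hpS']

/-! ### Counting connected elements -/

/-- The series `∑ⱼ X^(2j)`. -/
noncomputable def evenSeries : PowerSeries ℚ :=
  PowerSeries.mk fun n => if Even n then 1 else 0

theorem one_sub_sq_mul_evenSeries : (1 - PowerSeries.X ^ 2) * evenSeries = 1 := by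
  ext n
  rw [sub_mul, one_mul, map_sub, PowerSeries.coeff_X_pow_mul', PowerSeries.coeff_one, evenSeries,
    PowerSeries.coeff_mk]
  rcases n with - | - | n
  · simp
  · simp
  · have : Even (n + 2) ↔ Even n := by simp [Nat.even_add]
    simp [PowerSeries.coeff_mk, this]

/-- The squares beyond those needed to connect `S` can be added freely. -/
theorem IsSection.exists_connected {S : Finset (Fin d)} {s : Equiv.Perm (Fin d) → TMonoid d}
    (hs : IsSection S s) (hS : 2 ≤ S.card) {g : Equiv.Perm (Fin d)} (hg : g ∈ permsOn S) (j : ℕ) :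
    ∃ k, ∃ Q ∈ sqProd S (k + j), length (s g) + k + 1 = S.card ∧ Connects (s g * Q) S := by
  obtain ⟨x, hx, y, hy, hxy⟩ := Finset.one_lt_card.1 hS
  induction j with
  | zero => exact hs.connects ⟨x, hx⟩ g hg
  | succ j ih =>
    obtain ⟨k, Q, hQ, hk, hc⟩ := ih
    refine ⟨k, sq x y * Q, sq_mul_mem_sqProd hQ hx hy hxy, hk, hc.mono ?_⟩
    simp only [comp_mul]
    exact sup_le_sup_left le_sup_right _

/-- The connected elements over a fixed permutation: one for each length from the least possible one
on, in steps of two. -/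
theorem IsSection.series_fiber {S : Finset (Fin d)} {s : Equiv.Perm (Fin d) → TMonoid d}
    (hs : IsSection S s) (hS : 2 ≤ S.card) {g : Equiv.Perm (Fin d)} (hg : g ∈ permsOn S) :
    PowerSeries.X ^ 2 * series {u | u ∈ connectedSet S ∧ perm u = g} =
      PowerSeries.X ^ S.card * PowerSeries.X ^ (S.card - length (s g)) * evenSeries := by
  have hne : S.Nonempty := Finset.card_pos.1 (by omega)
  obtain ⟨k₀, -, -, hk₀, -⟩ := hs.connects hne g hg
  -- A connected element has at least `k₀` squares, hence length at least `N`.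
  obtain ⟨N, hN⟩ : ∃ N, N = length (s g) + 2 * k₀ := ⟨_, rfl⟩
  have hfac : ∀ u ∈ connectedSet S, perm u = g → ∃ k, ∃ Q ∈ sqProd S (k₀ + k),
      u = s g * Q ∧ length u = N + 2 * k := by
    rintro u hu rfl
    obtain ⟨k, Q, hQ, e⟩ := hs.exists_eq hu.1
    obtain ⟨h1, h2, -, E, h4, h5, h6⟩ := sqProd_spec hQ
    have hc : Connects (s (perm u) * E) S := by
      have := hu.2
      rw [e, Connects, comp_mul, ← h6, ← comp_mul] at this
      exact this
    have hle := card_le_length_add_one hne subset_rfl (mul_mem (hs.mem _ hg) h4) hc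
    rw [length_mul, h5] at hle
    obtain ⟨j, rfl⟩ : ∃ j, k = k₀ + j := Nat.exists_eq_add_of_le (by omega)
    refine ⟨j, Q, hQ, e, ?_⟩
    rw [e, length_mul, h2]
    omega
  have key : series {u | u ∈ connectedSet S ∧ perm u = g} = PowerSeries.X ^ N * evenSeries := by
    ext n
    rw [series, PowerSeries.coeff_mk, PowerSeries.coeff_X_pow_mul', evenSeries,
      PowerSeries.coeff_mk]
    by_cases hn : ∃ j, n = N + 2 * j
    · obtain ⟨j, rfl⟩ := hn
      obtain ⟨k, Q, hQ, hk, hc⟩ := hs.exists_connected hS hg j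
      obtain rfl : k = k₀ := by omega
      obtain ⟨h1, h2, h3, -⟩ := sqProd_spec hQ
      have : {u | u ∈ connectedSet S ∧ perm u = g} ∩ {a | length a = N + 2 * j} = {s g * Q} := by
        ext u
        simp only [Set.mem_inter_iff, Set.mem_ofPred_eq, Set.mem_singleton_iff]
        constructor
        · rintro ⟨⟨hu, hgu⟩, hl⟩
          obtain ⟨i, R, hR, e, hl'⟩ := hfac u hu hgu
          obtain rfl : i = j := by omega
          rw [e]
          exact mul_sqProd_eq hR hQ (e ▸ hu.2) hc
        · rintro rfl
          refine ⟨⟨⟨mul_mem (hs.mem _ hg) h1, hc⟩, ?_⟩, ?_⟩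
          · rw [map_mul, hs.perm_eq g hg, h3, mul_one]
          · rw [length_mul, h2]; omega
      rw [this, Set.ncard_singleton]
      simp
    · have : {u | u ∈ connectedSet S ∧ perm u = g} ∩ {a | length a = n} = ∅ := by
        ext u
        simp only [Set.mem_inter_iff, Set.mem_ofPred_eq, Set.mem_empty_iff_false, iff_false]
        rintro ⟨⟨hu, hgu⟩, hl⟩
        obtain ⟨i, R, hR, e, hl'⟩ := hfac u hu hgu
        exact hn ⟨i, by omega⟩
      rw [this, Set.ncard_empty, Nat.cast_zero]
      split_ifs with h1 h2
      · obtain ⟨r, hr⟩ := h2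
        exact absurd ⟨r, by omega⟩ hn
      · rfl
      · rfl
  rw [key, ← mul_assoc, ← pow_add, ← pow_add]
  congr 2
  omega

theorem connectedSet_of_card_eq_one {S : Finset (Fin d)} (hS : S.card = 1) :
    connectedSet S = {1} := by
  ext u
  constructor
  · exact fun hu => eq_one_of_mem_young hS.le hu.1
  · rintro rfl
    refine ⟨one_mem _, fun i hi j hj => ?_⟩
    rw [Finset.card_le_one.1 hS.le i hi j hj]

/-- The connected elements on `m` points, counted by length. For `m = 1` the only such element
is `1`, which accounts for the correction term. -/
theorem series_connectedSet {S : Finset (Fin d)} (hS : S.Nonempty) :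
    PowerSeries.X ^ 2 * (1 - PowerSeries.X ^ 2) * series (connectedSet S) =
      PowerSeries.X ^ S.card *
        ∏ i ∈ Finset.range S.card, (PowerSeries.X + (i : PowerSeries ℚ)) -
      if S.card = 1 then PowerSeries.X ^ 4 else 0 := by
  have hpos := Finset.card_pos.2 hS
  by_cases h1 : S.card = 1
  · rw [connectedSet_of_card_eq_one h1, series_one, h1]
    simp
    ring
  · rw [if_neg h1, sub_zero]
    obtain ⟨s, hs⟩ := exists_isSection S
    have hcard : 2 ≤ S.card := by omega
    have hU : connectedSet S =
        ⋃ g ∈ permsOn S, {u | u ∈ connectedSet S ∧ perm u = g} := by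
      ext u
      simp only [Set.mem_iUnion, Set.mem_ofPred_eq, exists_prop]
      exact ⟨fun hu => ⟨_, perm_mem_permsOn hu.1, hu, rfl⟩, fun ⟨_, _, hu, _⟩ => hu⟩
    have hsum : PowerSeries.X ^ 2 * series (connectedSet S) = PowerSeries.X ^ S.card *
        (∏ i ∈ Finset.range S.card, (PowerSeries.X + (i : PowerSeries ℚ))) * evenSeries := by
      rw [hU, series_biUnion, Finset.mul_sum,
        Finset.sum_congr rfl fun g hg => hs.series_fiber hcard hg, ← Finset.sum_mul,
        ← Finset.mul_sum, hs.sum_eq]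
      rintro i _ j _ a ⟨-, rfl⟩ ⟨-, rfl⟩
      rfl
    rw [mul_right_comm, hsum, mul_assoc, mul_comm evenSeries, one_sub_sq_mul_evenSeries, mul_one]

/-! ### The exponential generating series -/

theorem series_connectedSet_eq {d' : ℕ} {S : Finset (Fin d)} {S' : Finset (Fin d')}
    (hS : S.Nonempty) (h : S.card = S'.card) :
    series (connectedSet S) = series (connectedSet S') := by
  have hS' : S'.Nonempty := Finset.card_pos.1 (h ▸ Finset.card_pos.2 hS)
  have h0 : (PowerSeries.X ^ 2 * (1 - PowerSeries.X ^ 2) : PowerSeries ℚ) ≠ 0 :=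
    mul_ne_zero (pow_ne_zero _ PowerSeries.X_ne_zero)
      (left_ne_zero_of_mul_eq_one one_sub_sq_mul_evenSeries)
  apply mul_left_cancel₀ h0
  rw [series_connectedSet hS, series_connectedSet hS', h]

/-- The exponential generating series of the connected elements. -/
noncomputable def connectedEGF : PowerSeries (PowerSeries ℚ) :=
  PowerSeries.mk fun m => if m = 0 then 0 else
    (1 / (m.factorial : ℚ)) • series (connectedSet (Finset.univ : Finset (Fin m)))

theorem hasSubst_connectedEGF : PowerSeries.HasSubst connectedEGF :=
  PowerSeries.HasSubst.of_constantCoeff_zero' (by simp [connectedEGF])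

theorem derivative_formalExp_connectedEGF :
    PowerSeries.derivative (PowerSeries ℚ) (formalExp connectedEGF) =
      PowerSeries.derivative (PowerSeries ℚ) connectedEGF * formalExp connectedEGF := by
  rw [formalExp, PowerSeries.derivative_subst hasSubst_connectedEGF, PowerSeries.derivative_exp,
    mul_comm]

/-- Both sides satisfy the recursion obtained by splitting off the component of one point; for the
exponential this is its differential equation. -/
theorem coeff_formalExp_connectedEGF (B : Finset (Fin d)) :
    PowerSeries.coeff B.card (formalExp connectedEGF) =
      (1 / (B.card.factorial : ℚ)) • series (young B : Set (TMonoid d)) := by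
  generalize hn : B.card = n
  induction n using Nat.strong_induction_on generalizing B with
  | _ n ih =>
  rcases n with - | n
  · have hB : (young B : Set (TMonoid d)) = {1} := by
      ext a
      exact ⟨fun ha => eq_one_of_mem_young (by omega) ha, by rintro rfl; exact one_mem _⟩
    have h0 : PowerSeries.constantCoeff connectedEGF = 0 := by simp [connectedEGF]
    have h1 := PowerSeries.constantCoeff_subst_eq_zero h0 (PowerSeries.exp (PowerSeries ℚ) - 1)
      (by simp)
    rw [PowerSeries.subst_sub hasSubst_connectedEGF, ← PowerSeries.coe_substAlgHom
      hasSubst_connectedEGF, map_one, map_sub, map_one, sub_eq_zero] at h1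
    rw [hB, series_one, formalExp, PowerSeries.coeff_zero_eq_constantCoeff,
      ← PowerSeries.coe_substAlgHom hasSubst_connectedEGF]
    exact h1.trans (by simp)
  · obtain ⟨p, B, hp, rfl, hB⟩ := Finset.card_eq_succ.1 hn
    clear hn
    let F : ℕ → PowerSeries ℚ := fun k =>
      series (connectedSet (Finset.univ : Finset (Fin (k + 1)))) *
        (((n - k).factorial : ℚ) • PowerSeries.coeff (n - k) (formalExp connectedEGF))
    have hG : ∀ S ∈ B.powerset, series (connectedSet (insert p S)) *
        series (young (B \ S) : Set (TMonoid d)) = F S.card := by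
      intro S hS
      have hSB := Finset.mem_powerset.1 hS
      have hpS : p ∉ S := fun h => hp (hSB h)
      have hc : (B \ S).card = n - S.card := by rw [Finset.card_sdiff_of_subset hSB, hB]
      have hfac : ((n - S.card).factorial : ℚ) ≠ 0 := by positivity
      dsimp only [F]
      rw [ih _ (by omega) _ hc, smul_smul, mul_one_div_cancel hfac, one_smul]
      congr 1
      refine series_connectedSet_eq (Finset.insert_nonempty p S) ?_
      rw [Finset.card_insert_of_notMem hpS, Finset.card_univ, Fintype.card_fin]
    have hder := congrArg (PowerSeries.coeff n) derivative_formalExp_connectedEGF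
    rw [PowerSeries.coeff_derivative, PowerSeries.coeff_mul,
      Finset.Nat.sum_antidiagonal_eq_sum_range_succ_mk] at hder
    have hn1 : ((n : PowerSeries ℚ) + 1) ≠ 0 := fun h =>
      Nat.cast_add_one_ne_zero (R := ℚ) n (by simpa using congrArg PowerSeries.constantCoeff h)
    apply mul_right_cancel₀ hn1
    rw [hder, series_young_insert hp, Finset.sum_congr rfl hG, Finset.sum_powerset_apply_card F, hB,
      Finset.smul_sum, Finset.sum_mul]
    refine Finset.sum_congr rfl fun k hk => ?_
    have hkn : k ≤ n := Nat.lt_succ_iff.1 (Finset.mem_range.1 hk)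
    dsimp only [F]
    rw [PowerSeries.coeff_derivative, connectedEGF, PowerSeries.coeff_mk,
      if_neg (Nat.succ_ne_zero k), ← connectedEGF]
    have hcast : ∀ m : ℕ, ((m : PowerSeries ℚ) + 1) = ((m + 1 : ℕ) : ℚ) • (1 : PowerSeries ℚ) := by
      intro m
      rw [Nat.cast_smul_eq_nsmul, nsmul_eq_mul, mul_one]
      push_cast
      rfl
    rw [hcast, hcast, ← Nat.cast_smul_eq_nsmul ℚ]
    simp only [smul_mul_assoc, mul_smul_comm, mul_one, smul_smul]
    congr 1
    rw [Nat.cast_choose ℚ hkn, Nat.factorial_succ, Nat.factorial_succ]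
    push_cast
    field_simp

theorem pow_generators (n : ℕ) :
    generators (transpositionSolution d) ^ n = {a : TMonoid d | length a = n} := by
  induction n with
  | zero =>
    ext a
    rw [pow_zero, Set.mem_one]
    exact ⟨by rintro rfl; exact length_one, eq_one_of_length_eq_zero⟩
  | succ n ih =>
    ext a
    rw [pow_succ', ih]
    constructor
    · rintro ⟨_, ⟨x, rfl⟩, b, hb, rfl⟩
      obtain ⟨i, j, hij, -, e⟩ := exists_edge_eq x
      have hb' : length b = n := hb
      change length (_ * b) = n + 1
      rw [e, length_mul, length_edge hij, hb', add_comm]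
    · intro ha
      induction a using edge_induction with
      | one => exact absurd ha (by simp)
      | mul i j a hij _ =>
        have ha' : length (edge i j * a) = n + 1 := ha
        rw [length_mul, length_edge hij] at ha'
        refine Set.mul_mem_mul ⟨_, (edge_of_ne hij).symm⟩ ?_
        change length a = n
        omega

theorem transpositionGrowth_eq : transpositionGrowth d =
    series (young (Finset.univ : Finset (Fin d)) : Set (TMonoid d)) := by
  ext n
  rw [transpositionGrowth, growthSeries, series, PowerSeries.coeff_mk, PowerSeries.coeff_mk,
    young_univ]
  congr 2
  rw [sphere, Submonoid.coe_top, Set.univ_inter]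
  simp only [pow_generators]
  ext a
  simp only [Set.mem_sdiff, Set.mem_ofPred_eq, Set.mem_iUnion, exists_prop, not_exists, not_and]
  exact ⟨fun h => h.1, fun h => ⟨h, fun i hi hi' => by omega⟩⟩

theorem growthEGF_eq : growthEGF = formalExp connectedEGF := by
  ext1 m
  have := coeff_formalExp_connectedEGF (Finset.univ : Finset (Fin m))
  rw [Finset.card_univ, Fintype.card_fin] at this
  rw [this, growthEGF, PowerSeries.coeff_mk, transpositionGrowth_eq]

theorem factorial_smul_choose {R : Type*} [CommRing R] [BinomialRing R] (r : R) (n : ℕ) :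
    n.factorial • Ring.choose r n = ∏ i ∈ Finset.range n, (r - (i : R)) := by
  rw [← Ring.descPochhammer_eq_factorial_smul_choose]
  induction n with
  | zero => simp [Polynomial.smeval_one]
  | succ n ih =>
    rw [descPochhammer_succ_right, Polynomial.smeval_mul, ih, Finset.prod_range_succ,
      Polynomial.smeval_sub, Polynomial.smeval_X, Polynomial.smeval_natCast]
    simp

theorem coeff_binomialPower (n : ℕ) : PowerSeries.coeff n binomialPower =
    (1 / (n.factorial : ℚ)) • (PowerSeries.X ^ n *
      ∏ i ∈ Finset.range n, (PowerSeries.X + (i : PowerSeries ℚ))) := by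
  have h1 := PowerSeries.rescale_eq_subst (-PowerSeries.X : PowerSeries ℚ)
    (PowerSeries.binomialSeries (PowerSeries ℚ) (-PowerSeries.X : PowerSeries ℚ))
  rw [PowerSeries.smul_eq_C_mul, map_neg, neg_mul] at h1
  have hfac : (n.factorial : ℚ) ≠ 0 := by positivity
  rw [binomialPower, tVar, xVar, ← h1, PowerSeries.coeff_rescale,
    PowerSeries.binomialSeries_coeff, smul_eq_mul, mul_one]
  apply smul_right_injective _ hfac
  dsimp only
  rw [smul_smul, mul_one_div_cancel hfac, one_smul, ← mul_smul_comm, Nat.cast_smul_eq_nsmul,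
    factorial_smul_choose, ← Finset.card_range n, ← Finset.prod_const, ← Finset.prod_const,
    Finset.card_range, ← Finset.prod_mul_distrib, ← Finset.prod_mul_distrib]
  exact Finset.prod_congr rfl fun i _ => by ring

theorem tVar_mul_connectedEGF :
    tVar ^ 2 * (1 - tVar ^ 2) * connectedEGF = binomialPower - 1 - tVar ^ 4 * xVar := by
  have hC : tVar ^ 2 * (1 - tVar ^ 2) =
      PowerSeries.C (PowerSeries.X ^ 2 * (1 - PowerSeries.X ^ 2) : PowerSeries ℚ) := by
    simp [tVar]
  have hC' : tVar ^ 4 = PowerSeries.C (PowerSeries.X ^ 4 : PowerSeries ℚ) := by simp [tVar]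
  ext1 m
  rw [hC, hC', xVar, map_sub, map_sub, PowerSeries.coeff_C_mul, PowerSeries.coeff_C_mul,
    coeff_binomialPower, connectedEGF, PowerSeries.coeff_mk, PowerSeries.coeff_one,
    PowerSeries.coeff_X]
  rcases m with - | m
  · simp
  · have hne : (Finset.univ : Finset (Fin (m + 1))).Nonempty := Finset.univ_nonempty
    rw [if_neg (Nat.succ_ne_zero m), mul_smul_comm, series_connectedSet hne, Finset.card_univ,
      Fintype.card_fin, smul_sub, if_neg (Nat.succ_ne_zero m), sub_zero]
    congr 1
    split_ifs with h
    · simp [h]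
    · simp

end TranspositionMonoid

open TranspositionMonoid in
theorem mainTheorem5 :
    ∃ f : PowerSeries (PowerSeries ℚ),
      tVar ^ 2 * (1 - tVar ^ 2) * f = binomialPower - 1 - tVar ^ 4 * xVar ∧
      PowerSeries.constantCoeff f = 0 ∧
      growthEGF = formalExp f :=
  ⟨connectedEGF, tVar_mul_connectedEGF, by simp [connectedEGF], growthEGF_eq⟩
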